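/- **Conventions.** Fix a finite gate set consisting of unitary gates on at most two qubits and containing the Hadamard, $T$ and CNOT gates. A QPT algorithm is a polynomial-time uniform family of quantum circuits over this gate set, indexed by the security parameter $\lambda\in\mathbb N$; circuits may also add fresh qubits in state $|0\rangle$ and trace out qubits. "Negligible" means eventually smaller than $\lambda^{-a}$ for every $a$. $\sigma_m=I/2^m$ is the $m$-qubit maximally mixed state, entropies are in bits, and $\|\cdot\|_1$ is the trace norm. *VPRDM.* A keyed family $\{\rho_{k}\}_{k\in\{0,1\}^\lambda}$ of $n(\lambda)$-qubit density matrices, with $\lambda\le\operatorname{poly}(n)$, is a VPRDM with mixedness parameter $m=m(\lambda)$ if (i) a QPT algorithm maps $k$ to $\rho_k$; (ii) for every $t=\operatorname{poly}(\lambda)$ and every QPT algorithm $\mathcal A$, $\big|\Pr_{k}[\mathcal A(\rho_k^{\otimes t})=1]-\Pr_{\rho\leftarrow\eta_{n,m}}[\mathcal A(\rho^{\otimes t})=1]\big|$ is negligible, where $\eta_{n,m}$ is the ensemble of states $\operatorname{tr}_m|\psi\rangle\langle\psi|$ with $|\psi\rangle$ a Haar random $(n+m)$-qubit state; (iii) there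 is a QPT algorithm $\mathcal V$ with $\Pr[\mathcal V(\rho_k,k)=1]=1$ for all $k$, and with $\Pr_{k'\leftarrow\{0,1\}^\lambda\setminus\{k\}}[\mathcal V(\rho_k,k')=1]$ at most a negligible function of $\lambda$, the same for all $k$. *EFI pair.* Families $(\nu_{0,\lambda})_\lambda$, $(\nu_{1,\lambda})_\lambda$ of $n(\lambda)$-qubit states form an EFI pair if (1) for each $b\in\{0,1\}$ a QPT algorithm prepares $\nu_{b,\lambda}$ on input $1^\lambda$; (2) $\|\nu_{0,\lambda}-\nu_{1,\lambda}\|_1=\Omega(1/\operatorname{poly}(\lambda))$; (3) for every QPT algorithm $\mathcal A$, $|\Pr[\mathcal A(\nu_{0,\lambda})=1]-\Pr[\mathcal A(\nu_{1,\lambda})=1]|$ is negligible. **Theorem (noise-robust EFI pairs).** Let $0<c<\gamma<1$ be constants and let $n,m_0,m_1\le n$ be natural numbers depending on $\lambda$ with $\lambda=cn$ and $m_1=\gamma n$ up to rounding (that is, $|\lambda-cn|\le1$ and $|m_1-\gamma n|\le 1$) and $m_0\le\operatorname{polylog}(n)$. For $b\in\{0,1\}$ let $$\rho^{(b)}_k=U^{(b)}_k\big((|0\rangle\langle0|)^{\otimes(n-m_b)}\otimes\sigma_{m_b}\big)U^{(b)\dagger}_k,\qquad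 k\in\{0,1\}^\lambda,$$ with unitaries $U^{(b)}_k$, be a VPRDM with mixedness parameter $m_b$, and let $\nu_{b,\lambda}=2^{-\lambda}\sum_{k}\rho^{(b)}_k$. Let $\Gamma(\rho)=\sum_{i=1}^{r}p_iU_i\rho U_i^\dagger$ (with $r$, $p_i$, $U_i$ depending on $\lambda$, $p$ a probability vector and the $U_i$ unitary on $n$ qubits) be a mixed-unitary channel that is efficient, i.e. implemented by a QPT algorithm. If, for all sufficiently large $\lambda$, $$H(\{p_i\}_i)\;\le\; m_1-\lambda-m_0-2$$ (which is $n(\gamma-c)-m_0-2$ when $\lambda=cn$ and $m_1=\gamma n$ hold exactly), then $\big(\Gamma(\nu_{0,\lambda}),\Gamma(\nu_{1,\lambda})\big)$ is an EFI pair. -/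

import Mathlib

open Filter Topology MeasureTheory
open scoped Matrix Kronecker ComplexOrder

noncomputable section

/-! ### Qubit registers, operators, states -/

/-- Computational basis labels of `n` qubits. -/
abbrev Qubits (n : ℕ) := Fin n → Bool

/-- Operators on `n` qubits. -/
abbrev Op (n : ℕ) := Matrix (Qubits n) (Qubits n) ℂ

/-- Density matrices on `n` qubits. -/
def IsState {n : ℕ} (ρ : Op n) : Prop := ρ.PosSemidef ∧ ρ.trace = 1

/-- The basis state `|x⟩⟨x|`. -/
def ketbra {n : ℕ} (x : Qubits n) : Op n := Matrix.single x x 1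

/-- `ρ ⊗ σ`, where `ρ` lives on the first `a` qubits and `σ` on the last `b` qubits. -/
def tensorOp {a b : ℕ} (ρ : Op a) (σ : Op b) : Op (a + b) := fun x y =>
  ρ (fun i => x (Fin.castAdd b i)) (fun i => y (Fin.castAdd b i)) *
    σ (fun i => x (Fin.natAdd a i)) (fun i => y (Fin.natAdd a i))

/-- `t` copies `ρ^{⊗ t}`; qubit `i` of copy `j` is qubit `i + n * j` of the register. -/
def copies {n : ℕ} (t : ℕ) (ρ : Op n) : Op (t * n) := fun x y =>
  ∏ j : Fin t, ρ (fun i => x (finProdFinEquiv (j, i))) (fun i => y (finProdFinEquiv (j, i)))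

/-- The trace norm: the sum of the singular values. -/
def traceNorm {n : ℕ} (X : Op n) : ℝ :=
  ∑ i, Real.sqrt ((Matrix.isHermitian_conjTranspose_mul_self X).eigenvalues i)

/-- `(|0⟩⟨0|)^{⊗ (n-m)} ⊗ σ_m` on `n` qubits, where `σ_m` is maximally mixed (for `m ≤ n`). -/
def paddedMixed (n m : ℕ) : Op n :=
  Matrix.diagonal fun x => if ∀ i : Fin n, (i : ℕ) < n - m → x i = false then (1 / 2 ^ m : ℂ) else 0

/-! ### Quantum circuits -/

/-- Single-qubit Hadamard gate. -/
def hadamard : Matrix Bool Bool ℂ := fun a b =>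
  if a && b then -(1 / (Real.sqrt 2 : ℂ)) else 1 / (Real.sqrt 2 : ℂ)

/-- Single-qubit `T` gate `diag(1, e^{iπ/4})`. -/
def tGate : Matrix Bool Bool ℂ :=
  Matrix.diagonal fun a => if a then Complex.exp (Complex.I * (Real.pi / 4)) else 1

/-- The controlled NOT gate, with the first qubit as control. -/
def cnot : Matrix (Bool × Bool) (Bool × Bool) ℂ := fun x y =>
  if x = (y.1, xor y.1 y.2) then 1 else 0

/-- A finite set of gates on at most two qubits that contains the Hadamard, `T` and `CNOT` gates
(a one-qubit gate is written as a two-qubit gate that ignores its second qubit). -/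
structure GateSet where
  card : ℕ
  mat : Fin card → Matrix.unitaryGroup (Bool × Bool) ℂ
  has_hadamard : ∃ a, (mat a : Matrix (Bool × Bool) (Bool × Bool) ℂ) =
    hadamard ⊗ₖ (1 : Matrix Bool Bool ℂ)
  has_tGate : ∃ a, (mat a : Matrix (Bool × Bool) (Bool × Bool) ℂ) =
    tGate ⊗ₖ (1 : Matrix Bool Bool ℂ)
  has_cnot : ∃ a, (mat a : Matrix (Bool × Bool) (Bool × Bool) ℂ) = cnot

/-- The two-qubit operator `V` acting on qubits `i` and `j` of an `n`-qubit register. -/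
def onWires {n : ℕ} (V : Matrix (Bool × Bool) (Bool × Bool) ℂ) (i j : Fin n) : Op n := fun x y =>
  if ∀ l, l ≠ i → l ≠ j → x l = y l then V (x i, x j) (y i, y j) else 0

/-- General quantum circuits with `n` input and `m` output qubits: gates, adding a fresh qubit in
state `|0⟩` at the end of the register, and tracing out the last qubit of the register. -/
inductive Circuit (𝒢 : GateSet) : ℕ → ℕ → Type
  | nil (n : ℕ) : Circuit 𝒢 n n
  | gate {n m : ℕ} (a : Fin 𝒢.card) (i j : Fin n) (hij : i ≠ j) (c : Circuit 𝒢 n m) : Circuit 𝒢 n m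
  | new {n m : ℕ} (c : Circuit 𝒢 (n + 1) m) : Circuit 𝒢 n m
  | discard {n m : ℕ} (c : Circuit 𝒢 n m) : Circuit 𝒢 (n + 1) m

/-- `ρ ⊗ |0⟩⟨0|`. -/
def addZero {n : ℕ} (ρ : Op n) : Op (n + 1) := fun x y =>
  if x (Fin.last n) = false ∧ y (Fin.last n) = false then ρ (Fin.init x) (Fin.init y) else 0

/-- Partial trace over the last qubit. -/
def traceLast {n : ℕ} (ρ : Op (n + 1)) : Op n := fun x y =>
  ∑ b : Bool, ρ (Fin.snoc (α := fun _ => Bool) x b) (Fin.snoc (α := fun _ => Bool) y b)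

/-- The channel computed by a circuit. -/
def Circuit.run {𝒢 : GateSet} : {n m : ℕ} → Circuit 𝒢 n m → Op n → Op m
  | _, _, .nil _, ρ => ρ
  | _, _, .gate a i j _ c, ρ => c.run (onWires (𝒢.mat a).1 i j * ρ * (onWires (𝒢.mat a).1 i j)ᴴ)
  | _, _, .new c, ρ => c.run (addZero ρ)
  | _, _, .discard c, ρ => c.run (traceLast ρ)

/-- The probability that a circuit with one output qubit outputs `1` on input `ρ`. -/
def Circuit.accept {𝒢 : GateSet} {n : ℕ} (c : Circuit 𝒢 n 1) (ρ : Op n) : ℝ :=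
  (c.run ρ (fun _ => true) (fun _ => true)).re

/-- Instructions of a circuit description; qubits are given by their position. -/
inductive Instr (𝒢 : GateSet) : Type
  | gate (a : Fin 𝒢.card) (i j : ℕ)
  | new
  | discard

/-- The description of a circuit as a list of instructions. -/
def Circuit.descr {𝒢 : GateSet} : {n m : ℕ} → Circuit 𝒢 n m → List (Instr 𝒢)
  | _, _, .nil _ => []
  | _, _, .gate a i j _ c => .gate a i j :: c.descr
  | _, _, .new c => .new :: c.descr
  | _, _, .discard c => .discard :: c.descr

/-! ### Classical deterministic polynomial time, and uniform circuit families -/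

/-- Contents of the registers of a classical machine; every register is a stack of bits.
A program uses only finitely many registers. -/
abbrev Store := ℕ → List Bool

/-- The store in which register `0` holds `w` and all other registers are empty. -/
def Store.init (w : List Bool) : Store := Function.update (fun _ => []) 0 w

/-- Programs of the classical machine. It is a multi-stack machine with structured control (hence
polynomially equivalent to a Turing machine) which outputs a list of circuit instructions. -/
inductive Cmd (𝒢 : GateSet) : Type
  | skip
  | push (r : ℕ) (b : Bool)
  | pop (r : ℕ)
  /-- branch on: register `r` is empty / has top symbol `0` / has top symbol `1` -/
  | branch (r : ℕ) (p₀ p₁ p₂ : Cmd 𝒢)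
  /-- repeat `p` while register `r` is nonempty -/
  | loop (r : ℕ) (p : Cmd 𝒢)
  | seq (p q : Cmd 𝒢)
  /-- call `p` as a subroutine with its own registers, on the content of register `r` -/
  | call (r : ℕ) (p : Cmd 𝒢)
  /-- output the gate `a` on the qubits whose positions are the lengths of registers `r`, `r'` -/
  | emitGate (a : Fin 𝒢.card) (r r' : ℕ)
  | emitNew
  | emitDiscard

/-- `Exec p s s' o t`: from store `s`, the program `p` halts with store `s'` after `t` steps and has
output the instructions `o`. -/
inductive Exec {𝒢 : GateSet} : Cmd 𝒢 → Store → Store → List (Instr 𝒢) → ℕ → Prop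
  | skip (s : Store) : Exec .skip s s [] 1
  | push (s : Store) (r : ℕ) (b : Bool) :
      Exec (.push r b) s (Function.update s r (b :: s r)) [] 1
  | pop (s : Store) (r : ℕ) : Exec (.pop r) s (Function.update s r (s r).tail) [] 1
  | branch_nil {s s' : Store} {o : List (Instr 𝒢)} {t r : ℕ} {p₀ p₁ p₂ : Cmd 𝒢}
      (h : (s r).head? = none) (hp : Exec p₀ s s' o t) : Exec (.branch r p₀ p₁ p₂) s s' o (t + 1)
  | branch_zero {s s' : Store} {o : List (Instr 𝒢)} {t r : ℕ} {p₀ p₁ p₂ : Cmd 𝒢}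
      (h : (s r).head? = some false) (hp : Exec p₁ s s' o t) :
      Exec (.branch r p₀ p₁ p₂) s s' o (t + 1)
  | branch_one {s s' : Store} {o : List (Instr 𝒢)} {t r : ℕ} {p₀ p₁ p₂ : Cmd 𝒢}
      (h : (s r).head? = some true) (hp : Exec p₂ s s' o t) :
      Exec (.branch r p₀ p₁ p₂) s s' o (t + 1)
  | loop_stop {s : Store} {r : ℕ} {p : Cmd 𝒢} (h : s r = []) : Exec (.loop r p) s s [] 1
  | loop_step {s s' s'' : Store} {o o' : List (Instr 𝒢)} {t t' r : ℕ} {p : Cmd 𝒢}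
      (h : s r ≠ []) (hp : Exec p s s' o t) (hl : Exec (.loop r p) s' s'' o' t') :
      Exec (.loop r p) s s'' (o ++ o') (t + t' + 1)
  | seq {s s' s'' : Store} {o o' : List (Instr 𝒢)} {t t' : ℕ} {p q : Cmd 𝒢}
      (hp : Exec p s s' o t) (hq : Exec q s' s'' o' t') :
      Exec (.seq p q) s s'' (o ++ o') (t + t')
  | call {s s' : Store} {o : List (Instr 𝒢)} {t r : ℕ} {p : Cmd 𝒢}
      (hp : Exec p (Store.init (s r)) s' o t) : Exec (.call r p) s s o (t + (s r).length + 1)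
  | emitGate (s : Store) (a : Fin 𝒢.card) (r r' : ℕ) :
      Exec (.emitGate a r r') s s [.gate a (s r).length (s r').length] 1
  | emitNew (s : Store) : Exec .emitNew s s [.new] 1
  | emitDiscard (s : Store) : Exec .emitDiscard s s [.discard] 1

/-- A family of circuit descriptions is polynomial-time uniform if one program outputs the `κ`-th
description on input `1^κ` within a number of steps polynomial in `κ`. -/
def PolyTimeUniform {𝒢 : GateSet} (C : ℕ → List (Instr 𝒢)) : Prop :=
  ∃ (p : Cmd 𝒢) (q : Polynomial ℕ), ∀ κ, ∃ (s : Store) (t : ℕ),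
    Exec p (Store.init (List.replicate κ true)) s (C κ) t ∧ t ≤ q.eval κ

/-- Quantum polynomial-time (QPT) algorithms which, for security parameter `κ`, take `a κ` qubits
to `b κ` qubits: polynomial-time uniform families of quantum circuits. -/
structure QPT (𝒢 : GateSet) (a b : ℕ → ℕ) where
  circuit : ∀ κ, Circuit 𝒢 (a κ) (b κ)
  uniform : PolyTimeUniform fun κ => (circuit κ).descr

/-- Negligible functions. -/
def Negligible (μ : ℕ → ℝ) : Prop :=
  ∀ c : ℕ, ∃ n₀ : ℕ, ∀ n, n₀ < n → |μ n| < ((n : ℝ) ^ c)⁻¹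

/-- Polynomially bounded functions. -/
def PolyBounded (f : ℕ → ℕ) : Prop := ∃ q : Polynomial ℕ, ∀ κ, f κ ≤ q.eval κ

/-! ### Random states and verifiable pseudorandom density matrices -/

/-- The Haar measure on pure states of `n` qubits: the normalized surface measure of the unit
sphere of `(ℂ²)^{⊗ n}`. -/
def haarState (n : ℕ) :
    Measure (Metric.sphere (0 : EuclideanSpace ℂ (Qubits n)) 1) :=
  ((Measure.addHaar : Measure (EuclideanSpace ℂ (Qubits n))).toSphere Set.univ)⁻¹ •
    (Measure.addHaar : Measure (EuclideanSpace ℂ (Qubits n))).toSphere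

/-- `tr_m |ψ⟩⟨ψ|`: the reduced state of `ψ` on the first `n` of its `n + m` qubits. -/
def reducedState (n m : ℕ) (ψ : EuclideanSpace ℂ (Qubits (n + m))) : Op n := fun x y =>
  ∑ z : Qubits m, ψ (Fin.append x z) * star (ψ (Fin.append y z))

/-- A keyed family `ρ κ k` of density matrices on `n κ` qubits, with security parameter `κ` and keys
`k ∈ {0,1}^κ`, is a VPRDM (verifiable pseudorandom density matrix) with mixedness parameter `m`. -/
structure IsVPRDM (𝒢 : GateSet) (n m : ℕ → ℕ) (ρ : ∀ κ, Qubits κ → Op (n κ)) : Prop where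
  /-- every `ρ κ k` is a density matrix -/
  state : ∀ κ k, IsState (ρ κ k)
  /-- the security parameter is polynomially bounded in the number of qubits -/
  key_length : ∃ q : Polynomial ℕ, ∀ κ, κ ≤ q.eval (n κ)
  /-- efficient preparation: a QPT algorithm maps the key `k` to `ρ κ k` -/
  preparable : ∃ G : QPT 𝒢 (fun κ => κ) n, ∀ κ k, (G.circuit κ).run (ketbra k) = ρ κ k
  /-- polynomially many copies are computationally indistinguishable from as many copies of a
  state of the generalized Hilbert-Schmidt ensemble -/
  pseudorandom : ∀ t : ℕ → ℕ, PolyBounded t → ∀ A : QPT 𝒢 (fun κ => t κ * n κ) (fun _ => 1),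
    Negligible fun κ =>
      |(1 / 2 ^ κ) * ∑ k, (A.circuit κ).accept (copies (t κ) (ρ κ k)) -
        ∫ ψ, (A.circuit κ).accept (copies (t κ) (reducedState (n κ) (m κ) ψ.1))
          ∂(haarState (n κ + m κ))|
  /-- efficient verification: complete, and sound for a random wrong key -/
  verifiable : ∃ V : QPT 𝒢 (fun κ => κ + n κ) (fun _ => 1),
    (∀ κ k, (V.circuit κ).accept (tensorOp (ketbra k) (ρ κ k)) = 1) ∧
    ∃ μ : ℕ → ℝ, Negligible μ ∧ ∀ κ (k : Qubits κ),
      (1 / (2 ^ κ - 1)) * ∑ k' ∈ Finset.univ.erase k,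
        (V.circuit κ).accept (tensorOp (ketbra k') (ρ κ k)) ≤ μ κ

/-- The ensemble average `2^{-κ} ∑_k ρ_k` over all keys. -/
def keyAverage {n κ : ℕ} (ρ : Qubits κ → Op n) : Op n := (1 / 2 ^ κ : ℂ) • ∑ k, ρ k

/-! ### EFI pairs and mixed unitary noise -/

/-- `(ν₀, ν₁)` is an EFI pair: efficiently generated, statistically far, and computationally
indistinguishable. -/
structure IsEFI (𝒢 : GateSet) (n : ℕ → ℕ) (ν₀ ν₁ : ∀ κ, Op (n κ)) : Prop where
  /-- efficient generation of `ν₀`; the unique operator on zero qubits of trace one is `1` -/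
  generate_zero : ∃ G : QPT 𝒢 (fun _ => 0) n, ∀ κ, (G.circuit κ).run 1 = ν₀ κ
  /-- efficient generation of `ν₁` -/
  generate_one : ∃ G : QPT 𝒢 (fun _ => 0) n, ∀ κ, (G.circuit κ).run 1 = ν₁ κ
  /-- the trace norm distance is at least an inverse polynomial -/
  far : ∃ d : ℕ, ∀ᶠ κ : ℕ in atTop, ((κ : ℝ) ^ d)⁻¹ ≤ traceNorm (ν₀ κ - ν₁ κ)
  /-- no QPT algorithm distinguishes the two families -/
  indistinguishable : ∀ A : QPT 𝒢 n (fun _ => 1),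
    Negligible fun κ => |(A.circuit κ).accept (ν₀ κ) - (A.circuit κ).accept (ν₁ κ)|

/-- A mixed unitary channel `ρ ↦ ∑_{i=1}^r p_i U_i ρ U_i†` on `n` qubits, given by its probabilities
and unitaries. -/
structure MixedUnitary (n : ℕ) where
  r : ℕ
  p : Fin r → ℝ
  p_nonneg : ∀ i, 0 ≤ p i
  p_sum : ∑ i, p i = 1
  U : Fin r → Matrix.unitaryGroup (Qubits n) ℂ

/-- The action of a mixed unitary channel. -/
def MixedUnitary.apply {n : ℕ} (Γ : MixedUnitary n) (ρ : Op n) : Op n :=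
  ∑ i, (Γ.p i : ℂ) • ((Γ.U i).1 * ρ * (Γ.U i).1ᴴ)

/-- The Shannon entropy (in bits) of the probabilities of a mixed unitary channel. -/
def MixedUnitary.entropy {n : ℕ} (Γ : MixedUnitary n) : ℝ :=
  (∑ i, Real.negMulLog (Γ.p i)) / Real.log 2

/-- A family of mixed unitary channels is efficient if a QPT algorithm implements it. -/
def EfficientNoise (𝒢 : GateSet) (n : ℕ → ℕ) (Γ : ∀ κ, MixedUnitary (n κ)) : Prop :=
  ∃ D : QPT 𝒢 n n, ∀ κ (ρ : Op (n κ)), IsState ρ → (D.circuit κ).run ρ = (Γ κ).apply ρ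

end

/-! Generation and indistinguishability are formal. Circuits act linearly, so preparing a uniformly
mixed key (halves of Bell pairs), then the state, then the noise produces the noisy key average. By
invariance of the Haar measure, the mean of a random reduced state is `I / 2^n` whatever the
mixedness parameter. One-copy pseudorandomness therefore makes both key averages indistinguishable
from the same state, and an efficient channel placed before the distinguisher preserves this
(`IsVPRDM.negligible_keyAverage`).

The distance is a rank count. Put `h = m₁ - κ - m₀ - 2` and call an index heavy if `p_i ≥
2^(-(h+1))`. Since the entropy is at most `h`, Markov's inequality gives the heavy indices total
mass `q ≥ 1/(h+1)`, and there are at most `2^(h+1) q` of them. Let `K` be spanned by the supports of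
the rank-`2^m₀` states `U_i ρ₀_k U_i†` over heavy `i` and all `k`. Then `dim K ≤ 2^(h+1) q * 2^κ *
2^m₀ = q * 2^(m₁-1)`. The projection onto `K` has expectation at least `q` in the first noisy
average. In the second it is at most `dim K / 2^m₁ ≤ q/2`, as each state there is bounded by
`2^(-m₁)`. The trace norm is thus at least `q/2 ≥ 1/(2(h+1))`, an inverse polynomial because `h + 1
≤ n = O(κ)` (`MixedUnitary.one_div_le_traceNorm_sub`). -/

noncomputable section

/-! ### Composition and linearity of circuits -/

namespace Circuit

variable {𝒢 : GateSet}

/-- Sequential composition of circuits. -/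
def comp {l : ℕ} : {n m : ℕ} → Circuit 𝒢 n m → Circuit 𝒢 m l → Circuit 𝒢 n l
  | _, _, .nil _, d => d
  | _, _, .gate a i j hij c, d => .gate a i j hij (c.comp d)
  | _, _, .new c, d => .new (c.comp d)
  | _, _, .discard c, d => .discard (c.comp d)

theorem run_comp {n m l : ℕ} (c : Circuit 𝒢 n m) (d : Circuit 𝒢 m l) (ρ : Op n) :
    (c.comp d).run ρ = d.run (c.run ρ) := by
  induction c with
  | nil => rfl
  | gate a i j hij c ih => exact ih _ _
  | new c ih => exact ih _ _
  | discard c ih => exact ih _ _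

theorem descr_comp {n m l : ℕ} (c : Circuit 𝒢 n m) (d : Circuit 𝒢 m l) :
    (c.comp d).descr = c.descr ++ d.descr := by
  induction c with
  | nil => rfl
  | gate a i j hij c ih => simp [comp, descr, ih]
  | new c ih => simp [comp, descr, ih]
  | discard c ih => simp [comp, descr, ih]

/-- Relabelling of the number of input qubits along an equality. -/
def castInput {n n' m : ℕ} (h : n = n') (c : Circuit 𝒢 n m) : Circuit 𝒢 n' m := h ▸ c

theorem descr_castInput {n n' m : ℕ} (h : n = n') (c : Circuit 𝒢 n m) :
    (c.castInput h).descr = c.descr := by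
  subst h; rfl

theorem run_castInput {n n' m : ℕ} (h : n = n') (c : Circuit 𝒢 n m) (ρ : Op n') :
    (c.castInput h).run ρ =
      c.run (ρ.submatrix (fun x i => x (Fin.cast h.symm i)) (fun x i => x (Fin.cast h.symm i))) := by
  subst h; rfl

/-- Every instruction is linear on all matrices, not only on states. This lets averages over keys
and over Haar random states pass through a circuit. -/
theorem exists_linearMap_run {n m : ℕ} (c : Circuit 𝒢 n m) :
    ∃ L : Op n →ₗ[ℂ] Op m, ∀ ρ, c.run ρ = L ρ := by
  induction c with
  | nil => exact ⟨LinearMap.id, fun _ => rfl⟩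
  | @gate n m a i j hij c ih =>
    obtain ⟨L, hL⟩ := ih
    refine ⟨L ∘ₗ LinearMap.mulRight ℂ (onWires (𝒢.mat a).1 i j)ᴴ ∘ₗ
      LinearMap.mulLeft ℂ (onWires (𝒢.mat a).1 i j), fun ρ => ?_⟩
    simp [run, hL]
  | @new n m c ih =>
    obtain ⟨L, hL⟩ := ih
    refine ⟨L ∘ₗ { toFun := addZero, map_add' := ?_, map_smul' := ?_ }, fun ρ => hL _⟩
    · intro ρ σ
      ext x y
      simp only [addZero, Matrix.add_apply]
      split_ifs <;> simp
    · intro r ρ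
      ext x y
      simp only [addZero, Matrix.smul_apply, RingHom.id_apply]
      split_ifs <;> simp
  | @discard n m c ih =>
    obtain ⟨L, hL⟩ := ih
    refine ⟨L ∘ₗ { toFun := traceLast, map_add' := ?_, map_smul' := ?_ }, fun ρ => hL _⟩
    · intro ρ σ
      ext x y
      simp only [traceLast, Matrix.add_apply, Finset.sum_add_distrib]
    · intro r ρ
      ext x y
      simp only [traceLast, Matrix.smul_apply, RingHom.id_apply, Finset.smul_sum]

/-- The channel computed by a circuit, as a linear map. -/
def runLinear {n m : ℕ} (c : Circuit 𝒢 n m) : Op n →ₗ[ℂ] Op m :=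
  c.exists_linearMap_run.choose

theorem run_eq_runLinear {n m : ℕ} (c : Circuit 𝒢 n m) (ρ : Op n) : c.run ρ = c.runLinear ρ :=
  c.exists_linearMap_run.choose_spec ρ

end Circuit

/-! ### Uniformity -/

/-- Running each program through `call` gives both of them fresh registers and the same input `1^κ`,
so neither disturbs the other. -/
theorem PolyTimeUniform.append {𝒢 : GateSet} {C D : ℕ → List (Instr 𝒢)}
    (hC : PolyTimeUniform C) (hD : PolyTimeUniform D) :
    PolyTimeUniform fun κ => C κ ++ D κ := by
  obtain ⟨p, a, hp⟩ := hC
  obtain ⟨q, b, hq⟩ := hD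
  refine ⟨.seq (.call 0 p) (.call 0 q), a + b + 2 * Polynomial.X + 2, fun κ => ?_⟩
  obtain ⟨s, t, hs, ht⟩ := hp κ
  obtain ⟨s', t', hs', ht'⟩ := hq κ
  have h0 : Store.init (List.replicate κ true) 0 = List.replicate κ true := by simp [Store.init]
  refine ⟨_, _, .seq (.call (s' := s) (t := t) (by rwa [h0]))
    (.call (s' := s') (t := t') (by rwa [h0])), ?_⟩
  simp [h0]
  omega

/-- Sequential composition of QPT algorithms. -/
def QPT.comp {𝒢 : GateSet} {a b c : ℕ → ℕ} (A : QPT 𝒢 a b) (B : QPT 𝒢 b c) : QPT 𝒢 a c where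
  circuit κ := (A.circuit κ).comp (B.circuit κ)
  uniform := by
    simpa only [Circuit.descr_comp] using A.uniform.append B.uniform

/-- Relabelling of the number of input qubits of a QPT algorithm along an equality. -/
def QPT.castInput {𝒢 : GateSet} {a a' b : ℕ → ℕ} (h : ∀ κ, a κ = a' κ) (A : QPT 𝒢 a b) :
    QPT 𝒢 a' b where
  circuit κ := (A.circuit κ).castInput (h κ)
  uniform := by
    simpa only [Circuit.descr_castInput] using A.uniform

/-- Pseudorandomness at `t = 1` speaks of a register of `1 * n` qubits; this identifies it with one
of `n` qubits. -/
theorem copies_one_submatrix {n : ℕ} (ρ : Op n) :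
    (copies 1 ρ).submatrix (fun x i => x (Fin.cast (one_mul n) i))
      (fun x i => x (Fin.cast (one_mul n) i)) = ρ := by
  ext x y
  have h : ∀ i : Fin n, Fin.cast (one_mul n) (finProdFinEquiv ((0 : Fin 1), i)) = i := fun i => by
    ext; simp
  simp [copies, h]

/-! ### Preparing a maximally mixed register -/

/-- The circuit that appends a maximally mixed qubit, as one half of a Bell pair. -/
def mixedQubitCircuit {𝒢 : GateSet} (h t : Fin 𝒢.card) (n : ℕ) : Circuit 𝒢 n (n + 1) :=
  .new <| .new <| .gate h (Fin.last n).castSucc (Fin.last (n + 1)) (Fin.castSucc_lt_last _).ne <|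
    .gate t (Fin.last n).castSucc (Fin.last (n + 1)) (Fin.castSucc_lt_last _).ne <|
    .discard <| .nil _

/-- The circuit that prepares `n` maximally mixed qubits. -/
def mixedCircuit {𝒢 : GateSet} (h t : Fin 𝒢.card) : (n : ℕ) → Circuit 𝒢 0 n
  | 0 => .nil 0
  | n + 1 => (mixedCircuit h t n).comp (mixedQubitCircuit h t n)

/-- Splitting off the last two qubits. -/
def splitLastTwo (n : ℕ) : Qubits n × (Bool × Bool) ≃ Qubits (n + 1 + 1) where
  toFun z := Fin.snoc (α := fun _ => Bool) (Fin.snoc (α := fun _ => Bool) z.1 z.2.1) z.2.2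
  invFun x := (Fin.init (Fin.init x), x (Fin.last n).castSucc, x (Fin.last (n + 1)))
  left_inv := by rintro ⟨x, a, b⟩; simp
  right_inv x := by
    have : x (Fin.last n).castSucc = Fin.init x (Fin.last n) := rfl
    simp only [this, Fin.snoc_init_self]

@[simp]
theorem splitLastTwo_last {n : ℕ} (z : Qubits n × (Bool × Bool)) :
    splitLastTwo n z (Fin.last (n + 1)) = z.2.2 := by
  simp [splitLastTwo]

@[simp]
theorem splitLastTwo_castSucc_last {n : ℕ} (z : Qubits n × (Bool × Bool)) :
    splitLastTwo n z (Fin.last n).castSucc = z.2.1 := by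
  simp [splitLastTwo]

@[simp]
theorem splitLastTwo_castSucc_castSucc {n : ℕ} (z : Qubits n × (Bool × Bool)) (i : Fin n) :
    splitLastTwo n z i.castSucc.castSucc = z.1 i := by
  simp [splitLastTwo]

theorem onWires_submatrix_splitLastTwo (n : ℕ) (V : Matrix (Bool × Bool) (Bool × Bool) ℂ) :
    (onWires V (Fin.last n).castSucc (Fin.last (n + 1))).submatrix
      (splitLastTwo n) (splitLastTwo n) = (1 : Op n) ⊗ₖ V := by
  ext z w
  have h : (∀ l, l ≠ (Fin.last n).castSucc → l ≠ Fin.last (n + 1) →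
      splitLastTwo n z l = splitLastTwo n w l) ↔ z.1 = w.1 := by
    simp [Fin.forall_fin_succ', funext_iff, Fin.castSucc_ne_last]
  simp [onWires, h, Matrix.one_apply]

theorem addZero_addZero_submatrix_splitLastTwo {n : ℕ} (ρ : Op n) :
    (addZero (addZero ρ)).submatrix (splitLastTwo n) (splitLastTwo n) =
      ρ ⊗ₖ Matrix.single (false, false) (false, false) 1 := by
  ext ⟨x, a, b⟩ ⟨y, a', b'⟩
  cases a <;> cases b <;> cases a' <;> cases b' <;>
    simp [addZero, splitLastTwo]

/-- The density matrix of a Bell pair. -/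
def bellState : Matrix (Bool × Bool) (Bool × Bool) ℂ := fun x y =>
  if x.1 = x.2 ∧ y.1 = y.2 then 1 / 2 else 0

theorem bellState_eq : cnot * ((hadamard ⊗ₖ (1 : Matrix Bool Bool ℂ)) *
    Matrix.single (false, false) (false, false) 1 * (hadamard ⊗ₖ (1 : Matrix Bool Bool ℂ))ᴴ) *
    cnotᴴ = bellState := by
  have h2 : ((Real.sqrt 2 : ℝ) : ℂ) * (Real.sqrt 2 : ℝ) = 2 := by
    rw [← Complex.ofReal_mul, Real.mul_self_sqrt (by norm_num)]; simp
  have h3 : ((Real.sqrt 2 : ℝ) : ℂ)⁻¹ * ((Real.sqrt 2 : ℝ) : ℂ)⁻¹ = 2⁻¹ := by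
    rw [← mul_inv, h2]
  ext ⟨a, b⟩ ⟨a', b'⟩
  simp only [Matrix.mul_apply, Fintype.sum_prod_type, Fintype.sum_bool]
  cases a <;> cases b <;> cases a' <;> cases b' <;>
    simp [cnot, hadamard, bellState, h3]

/-- In the coordinates of `splitLastTwo` both gates become `1 ⊗ V`, so the last two qubits carry a
Bell pair, and tracing out one half leaves `I/2` on the other. -/
theorem run_mixedQubitCircuit {𝒢 : GateSet} {h t : Fin 𝒢.card}
    (hh : (𝒢.mat h : Matrix (Bool × Bool) (Bool × Bool) ℂ) = hadamard ⊗ₖ (1 : Matrix Bool Bool ℂ))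
    (ht : (𝒢.mat t : Matrix (Bool × Bool) (Bool × Bool) ℂ) = cnot) (n : ℕ) :
    (mixedQubitCircuit h t n).run (1 : Op n) = (1 / 2 : ℂ) • (1 : Op (n + 1)) := by
  set i := (Fin.last n).castSucc
  set j := Fin.last (n + 1)
  set X : Op (n + 1 + 1) := onWires (𝒢.mat t).1 i j * (onWires (𝒢.mat h).1 i j *
    addZero (addZero 1) * (onWires (𝒢.mat h).1 i j)ᴴ) * (onWires (𝒢.mat t).1 i j)ᴴ with hX
  have h1 : X.submatrix (splitLastTwo n) (splitLastTwo n) = (1 : Op n) ⊗ₖ bellState := by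
    rw [hX]
    simp only [← Matrix.submatrix_mul_equiv _ _ _ (splitLastTwo n) _,
      ← Matrix.conjTranspose_submatrix, onWires_submatrix_splitLastTwo, i, j,
      addZero_addZero_submatrix_splitLastTwo, Matrix.conjTranspose_kronecker,
      ← Matrix.mul_kronecker_mul, Matrix.conjTranspose_one, mul_one]
    rw [← bellState_eq, hh, ht]
  have h2 (x y : Qubits (n + 1)) (b : Bool) :
      X (Fin.snoc (α := fun _ => Bool) x b) (Fin.snoc (α := fun _ => Bool) y b) =
        (1 : Op n) (Fin.init x) (Fin.init y) *
          bellState (x (Fin.last n), b) (y (Fin.last n), b) := by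
    have h3 (x : Qubits (n + 1)) : Fin.snoc (α := fun _ => Bool) x b =
        splitLastTwo n (Fin.init x, (x (Fin.last n), b)) := by
      simp [splitLastTwo]
    rw [h3, h3]
    exact congrFun₂ h1 _ _
  change traceLast X = _
  ext x y
  have h4 : x = y ↔ Fin.init x = Fin.init y ∧ x (Fin.last n) = y (Fin.last n) := by
    simp [funext_iff, Fin.forall_fin_succ', Fin.init]
  simp only [traceLast, h2, bellState, Matrix.smul_apply, Matrix.one_apply, h4]
  by_cases h5 : Fin.init x = Fin.init y <;> cases x (Fin.last n) <;> cases y (Fin.last n) <;>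
    simp [h5]

theorem run_mixedCircuit {𝒢 : GateSet} {h t : Fin 𝒢.card}
    (hh : (𝒢.mat h : Matrix (Bool × Bool) (Bool × Bool) ℂ) = hadamard ⊗ₖ (1 : Matrix Bool Bool ℂ))
    (ht : (𝒢.mat t : Matrix (Bool × Bool) (Bool × Bool) ℂ) = cnot) (n : ℕ) :
    (mixedCircuit h t n).run (1 : Op 0) = (1 / 2 ^ n : ℂ) • (1 : Op n) := by
  induction n with
  | zero => simp [mixedCircuit, Circuit.run]
  | succ n ih =>
    rw [mixedCircuit, Circuit.run_comp, ih, Circuit.run_eq_runLinear, map_smul,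
      ← Circuit.run_eq_runLinear, run_mixedQubitCircuit hh ht, smul_smul]
    congr 1
    field_simp
    ring

/-- The instructions of `mixedQubitCircuit`. -/
def mixedQubitDescr {𝒢 : GateSet} (h t : Fin 𝒢.card) (n : ℕ) : List (Instr 𝒢) :=
  [.new, .new, .gate h n (n + 1), .gate t n (n + 1), .discard]

theorem descr_mixedCircuit {𝒢 : GateSet} (h t : Fin 𝒢.card) (n : ℕ) :
    (mixedCircuit h t n).descr = (List.range' 0 n).flatMap (mixedQubitDescr h t) := by
  induction n with
  | zero => rfl
  | succ n ih =>
    rw [mixedCircuit, Circuit.descr_comp, ih, List.range'_concat]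
    simp [mixedQubitCircuit, mixedQubitDescr, Circuit.descr]

/-- The loop body of the program that outputs the descriptions of `mixedCircuit`. -/
def mixedBody {𝒢 : GateSet} (h t : Fin 𝒢.card) : Cmd 𝒢 :=
  .seq .emitNew <| .seq .emitNew <| .seq (.emitGate h 1 2) <| .seq (.emitGate t 1 2) <|
    .seq .emitDiscard <| .seq (.push 1 true) <| .seq (.push 2 true) (.pop 0)

/-- Loop invariant: the lengths of registers 1 and 2 are the positions `n` and `n + 1` of the two
fresh qubits, while register 0 counts the remaining rounds. The cost 8 is one step per primitive
command. -/
theorem exec_mixedBody {𝒢 : GateSet} (h t : Fin 𝒢.card) {s : Store} {n : ℕ}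
    (h1 : (s 1).length = n) (h2 : (s 2).length = n + 1) :
    ∃ s' : Store, Exec (mixedBody h t) s s' (mixedQubitDescr h t n) 8 ∧
      s' 0 = (s 0).tail ∧ (s' 1).length = n + 1 ∧ (s' 2).length = n + 2 := by
  have e := Exec.seq (.emitNew s) <| .seq (.emitNew s) <| .seq (.emitGate s h 1 2) <|
    .seq (.emitGate s t 1 2) <| .seq (.emitDiscard s) <| .seq (.push s 1 true) <|
    .seq (.push _ 2 true) (.pop _ 0)
  rw [h1, h2] at e
  refine ⟨_, e, ?_, ?_, ?_⟩ <;> simp [Function.update, h1, h2]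

theorem exec_loop_mixedBody {𝒢 : GateSet} (h t : Fin 𝒢.card) (k : ℕ) {s : Store} {n : ℕ}
    (h0 : s 0 = List.replicate k true) (h1 : (s 1).length = n) (h2 : (s 2).length = n + 1) :
    ∃ s' : Store, Exec (.loop 0 (mixedBody h t)) s s'
      ((List.range' n k).flatMap (mixedQubitDescr h t)) (9 * k + 1) := by
  induction k generalizing s n with
  | zero => exact ⟨s, by constructor; simpa using h0⟩
  | succ k ih =>
    obtain ⟨s', e, g0, g1, g2⟩ := exec_mixedBody h t h1 h2
    obtain ⟨s'', e'⟩ := ih (s := s') (by simp [g0, h0]) g1 g2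
    refine ⟨s'', ?_⟩
    have := Exec.loop_step (by simp [h0]) e e'
    rw [List.range'_succ, List.flatMap_cons]
    convert this using 1
    ring

theorem polyTimeUniform_mixedCircuit {𝒢 : GateSet} (h t : Fin 𝒢.card) :
    PolyTimeUniform fun κ => (mixedCircuit h t κ).descr := by
  -- The initial push gives register 2 length `0 + 1`, as the invariant demands at `n = 0`. Each
  -- round costs 8 steps plus 1 for the loop test.
  refine ⟨.seq (.push 2 true) (.loop 0 (mixedBody h t)), 9 * Polynomial.X + 2, fun κ => ?_⟩
  obtain ⟨s, e⟩ := exec_loop_mixedBody h t κ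
    (s := Function.update (Store.init (List.replicate κ true)) 2 [true]) (n := 0)
    (by simp [Store.init, Function.update]) (by simp [Store.init, Function.update])
    (by simp)
  refine ⟨s, 1 + (9 * κ + 1), ?_, le_of_eq ?_⟩
  · simp only [descr_mixedCircuit]
    exact .seq (.push _ 2 true) e
  · simp
    ring

theorem exists_qpt_mixed (𝒢 : GateSet) :
    ∃ M : QPT 𝒢 (fun _ => 0) (fun κ => κ),
      ∀ κ, (M.circuit κ).run 1 = (1 / 2 ^ κ : ℂ) • (1 : Op κ) := by
  obtain ⟨h, hh⟩ := 𝒢.has_hadamard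
  obtain ⟨t, ht⟩ := 𝒢.has_cnot
  exact ⟨⟨mixedCircuit h t, polyTimeUniform_mixedCircuit h t⟩, run_mixedCircuit hh ht⟩

/-- This turns the maximally mixed register into a uniformly random classical key. -/
theorem sum_ketbra (n : ℕ) : ∑ k : Qubits n, ketbra k = 1 := by
  ext x y
  simp [ketbra, Matrix.sum_apply, Matrix.single_apply, Matrix.one_apply, ite_and]

/-- Key averages of efficiently preparable families are efficiently preparable. -/
theorem exists_qpt_keyAverage {𝒢 : GateSet} {n : ℕ → ℕ} {ρ : ∀ κ, Qubits κ → Op (n κ)}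
    (G : QPT 𝒢 (fun κ => κ) n) (hG : ∀ κ k, (G.circuit κ).run (ketbra k) = ρ κ k) :
    ∃ P : QPT 𝒢 (fun _ => 0) n, ∀ κ, (P.circuit κ).run 1 = keyAverage (ρ κ) := by
  obtain ⟨M, hM⟩ := exists_qpt_mixed 𝒢
  refine ⟨M.comp G, fun κ => ?_⟩
  rw [QPT.comp, Circuit.run_comp, hM, Circuit.run_eq_runLinear, map_smul, ← sum_ketbra, map_sum,
    keyAverage]
  simp only [← Circuit.run_eq_runLinear, hG]

/-! ### Second moments of Haar random states -/

section Isometry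

open scoped Pointwise

variable {E : Type*} [NormedAddCommGroup E] [NormedSpace ℝ E]

/-- The action of a linear isometry on the unit sphere. -/
def LinearIsometryEquiv.sphereMap (L : E ≃ₗᵢ[ℝ] E) (x : Metric.sphere (0 : E) 1) :
    Metric.sphere (0 : E) 1 :=
  ⟨L x, by simp⟩

theorem LinearIsometryEquiv.continuous_sphereMap (L : E ≃ₗᵢ[ℝ] E) : Continuous L.sphereMap :=
  (L.continuous.comp continuous_subtype_val).subtype_mk _

variable [FiniteDimensional ℝ E] [MeasurableSpace E] [BorelSpace E]

/-- The image measure is again Haar, hence a multiple of `μ`; the factor is 1 because the unit ball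
is preserved and has finite positive measure. -/
theorem LinearIsometryEquiv.map_isAddHaarMeasure (L : E ≃ₗᵢ[ℝ] E) (μ : Measure E)
    [μ.IsAddHaarMeasure] : μ.map L = μ := by
  have : (μ.map L).IsAddHaarMeasure :=
    L.toContinuousLinearEquiv.isAddHaarMeasure_map μ
  have h := Measure.isAddLeftInvariant_eq_smul (μ.map L) μ
  have hb : μ.map L (Metric.ball 0 1) = μ (Metric.ball 0 1) := by
    rw [Measure.map_apply L.continuous.measurable Metric.isOpen_ball.measurableSet]
    simp
  rw [h] at hb ⊢
  rw [Measure.smul_apply, ENNReal.smul_def, smul_eq_mul] at hb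
  have h1 : ((Measure.addHaarScalarFactor (μ.map L) μ : NNReal) : ENNReal) = 1 :=
    (ENNReal.mul_eq_right (Metric.measure_ball_pos μ 0 one_pos).ne' measure_ball_lt_top.ne).1 hb
  have h2 : Measure.addHaarScalarFactor (μ.map L) μ = 1 := by exact_mod_cast h1
  rw [h2, one_smul]

/-- The surface measure of a set is determined by the volume of the cone over it, and a linear
isometry carries cones to cones. -/
theorem LinearIsometryEquiv.map_toSphere (L : E ≃ₗᵢ[ℝ] E) (μ : Measure E)
    [μ.IsAddHaarMeasure] : μ.toSphere.map L.sphereMap = μ.toSphere := by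
  ext s hs
  rw [Measure.map_apply L.continuous_sphereMap.measurable hs,
    Measure.toSphere_apply' _ (L.continuous_sphereMap.measurable hs), Measure.toSphere_apply' _ hs]
  congr 1
  have h : Set.Ioo (0 : ℝ) 1 • ((↑) '' (L.sphereMap ⁻¹' s) : Set E) =
      L ⁻¹' (Set.Ioo (0 : ℝ) 1 • ((↑) '' s)) := by
    ext x
    simp only [Set.mem_smul, Set.mem_image, Set.mem_preimage]
    constructor
    · rintro ⟨r, hr, _, ⟨y, hy, rfl⟩, rfl⟩
      exact ⟨r, hr, _, ⟨_, hy, rfl⟩, by simp [sphereMap]⟩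
    · rintro ⟨r, hr, _, ⟨y, hy, rfl⟩, hx⟩
      have : L.sphereMap (L.symm.sphereMap y) = y := by
        ext; simp [sphereMap]
      exact ⟨r, hr, _, ⟨L.symm.sphereMap y, by rwa [this], rfl⟩,
        L.injective (by simp [sphereMap, hx])⟩
  rw [h]
  conv_rhs => rw [← L.map_isAddHaarMeasure μ]
  exact (L.toHomeomorph.toMeasurableEquiv.map_apply _).symm

end Isometry

/-! ### Moments of the Haar measure on pure states -/

instance isProbabilityMeasure_haarState (n : ℕ) : IsProbabilityMeasure (haarState n) := by
  constructor
  rw [haarState, Measure.smul_apply, smul_eq_mul]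
  refine ENNReal.inv_mul_cancel ?_ (measure_ne_top _ _)
  rw [Measure.measure_univ_ne_zero]
  exact Measure.toSphere_ne_zero _

theorem map_haarState {n : ℕ}
    (L : EuclideanSpace ℂ (Qubits n) ≃ₗᵢ[ℝ] EuclideanSpace ℂ (Qubits n)) :
    (haarState n).map L.sphereMap = haarState n := by
  rw [haarState, Measure.map_smul, L.map_toSphere]

theorem integral_haarState_comp {n : ℕ}
    (L : EuclideanSpace ℂ (Qubits n) ≃ₗᵢ[ℝ] EuclideanSpace ℂ (Qubits n))
    {f : EuclideanSpace ℂ (Qubits n) → ℂ} (hf : Continuous f) :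
    ∫ ψ, f (L ψ.1) ∂(haarState n) = ∫ ψ, f ψ.1 ∂(haarState n) := by
  conv_rhs => rw [← map_haarState L]
  exact (integral_map L.continuous_sphereMap.aemeasurable
    (hf.comp continuous_subtype_val).aestronglyMeasurable).symm

theorem continuous_coord_mul_star {n : ℕ} (a b : Qubits n) :
    Continuous fun ψ : EuclideanSpace ℂ (Qubits n) => ψ a * star (ψ b) := by
  fun_prop

theorem integrable_haarState {n : ℕ} {f : EuclideanSpace ℂ (Qubits n) → ℂ} (hf : Continuous f) :
    Integrable (fun ψ => f ψ.1) (haarState n) :=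
  (hf.comp continuous_subtype_val).integrable_of_hasCompactSupport
    (HasCompactSupport.of_compactSpace _)

/-- Flipping the sign of coordinate `a` is an isometry that negates the integrand. -/
theorem integral_haarState_of_ne {n : ℕ} {a b : Qubits n} (hab : a ≠ b) :
    ∫ ψ, ψ.1 a * star (ψ.1 b) ∂(haarState n) = 0 := by
  let L : EuclideanSpace ℂ (Qubits n) ≃ₗᵢ[ℝ] EuclideanSpace ℂ (Qubits n) :=
    LinearIsometryEquiv.piLpCongrRight 2 fun c =>
      if c = a then LinearIsometryEquiv.neg ℝ else LinearIsometryEquiv.refl ℝ ℂ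
  have h := integral_haarState_comp L (continuous_coord_mul_star a b)
  have ha (ψ : EuclideanSpace ℂ (Qubits n)) : L ψ a = -ψ a := by simp [L]
  have hb (ψ : EuclideanSpace ℂ (Qubits n)) : L ψ b = ψ b := by simp [L, hab.symm]
  simp only [ha, hb, neg_mul, integral_neg] at h
  exact self_eq_neg.1 h.symm

theorem integral_haarState_self_eq {n : ℕ} (a b : Qubits n) :
    ∫ ψ, ψ.1 a * star (ψ.1 a) ∂(haarState n) = ∫ ψ, ψ.1 b * star (ψ.1 b) ∂(haarState n) := by
  let L : EuclideanSpace ℂ (Qubits n) ≃ₗᵢ[ℝ] EuclideanSpace ℂ (Qubits n) :=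
    LinearIsometryEquiv.piLpCongrLeft 2 ℝ ℂ (Equiv.swap a b)
  have h := integral_haarState_comp L (continuous_coord_mul_star b b)
  have ha (ψ : EuclideanSpace ℂ (Qubits n)) : L ψ b = ψ a := by
    simp [L, LinearIsometryEquiv.piLpCongrLeft_apply, Equiv.piCongrLeft']
  simpa only [ha] using h

/-- The diagonal moments agree by swapping coordinates and sum to `‖ψ‖² = 1`. -/
theorem integral_haarState {n : ℕ} (a b : Qubits n) :
    ∫ ψ, ψ.1 a * star (ψ.1 b) ∂(haarState n) = if a = b then 1 / 2 ^ n else 0 := by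
  split_ifs with hab
  · subst hab
    have h1 : ∑ c, ∫ ψ, ψ.1 c * star (ψ.1 c) ∂(haarState n) = 1 := by
      rw [← integral_finsetSum _ fun c _ => integrable_haarState (continuous_coord_mul_star c c)]
      have (ψ : Metric.sphere (0 : EuclideanSpace ℂ (Qubits n)) 1) :
          ∑ c, ψ.1 c * star (ψ.1 c) = 1 := by
        have h := EuclideanSpace.norm_sq_eq ψ.1
        rw [norm_eq_of_mem_sphere] at h
        have h' : ∀ c, ψ.1 c * star (ψ.1 c) = ((‖ψ.1 c‖ ^ 2 : ℝ) : ℂ) := fun c => by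
          simpa using Complex.mul_conj' (ψ.1 c)
        simp only [h', ← Complex.ofReal_sum, ← h]
        simp
      simp only [this, integral_const, probReal_univ, one_smul]
    rw [Finset.sum_congr rfl fun c _ => integral_haarState_self_eq c a] at h1
    simp only [Finset.sum_const, Finset.card_univ, Fintype.card_fun, Fintype.card_bool,
      Fintype.card_fin, nsmul_eq_mul, Nat.cast_pow, Nat.cast_ofNat] at h1
    rw [eq_div_iff (by positivity), mul_comm, h1]
  · exact integral_haarState_of_ne hab

theorem continuous_reducedState {n m : ℕ} (x y : Qubits n) :
    Continuous fun ψ => reducedState n m ψ x y :=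
  continuous_finsetSum _ fun _ _ => continuous_coord_mul_star _ _

/-- Each of the `2^m` traced-out labels contributes `1 / 2^(n+m)` on the diagonal, so `m` cancels.
-/
theorem integral_reducedState {n m : ℕ} (x y : Qubits n) :
    ∫ ψ, reducedState n m ψ.1 x y ∂(haarState (n + m)) = ((1 / 2 ^ n : ℂ) • (1 : Op n)) x y := by
  simp only [reducedState]
  rw [integral_finsetSum _ fun c _ => integrable_haarState (continuous_coord_mul_star _ _)]
  have h (z : Qubits m) : Fin.append x z = Fin.append y z ↔ x = y := by
    constructor
    · intro h
      ext i
      simpa using congrFun h (Fin.castAdd m i)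
    · rintro rfl; rfl
  simp only [integral_haarState, h]
  by_cases hxy : x = y
  · simp [hxy, pow_add]
  · simp [hxy]

/-- The expectation of a linear functional of a Haar random reduced state is its value at the
maximally mixed state. -/
theorem integral_re_linear_reducedState {n m : ℕ} (f : Op n →ₗ[ℂ] ℂ) :
    ∫ ψ, (f (reducedState n m ψ.1)).re ∂(haarState (n + m)) =
      (f ((1 / 2 ^ n : ℂ) • (1 : Op n))).re := by
  have hf (A : Op n) : f A = ∑ x, ∑ y, A x y * f (Matrix.single x y 1) := by
    conv_lhs => rw [Matrix.matrix_eq_sum_single A]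
    simp only [map_sum]
    refine Finset.sum_congr rfl fun x _ => Finset.sum_congr rfl fun y _ => ?_
    rw [← smul_eq_mul, ← map_smul, Matrix.smul_single, smul_eq_mul, mul_one]
  have hi (x y : Qubits n) : Integrable (fun ψ => reducedState n m ψ.1 x y *
      f (Matrix.single x y 1)) (haarState (n + m)) :=
    (integrable_haarState (continuous_reducedState x y)).mul_const _
  have hi' : Integrable (fun ψ => f (reducedState n m ψ.1)) (haarState (n + m)) := by
    simp only [fun ψ => hf (reducedState n m ψ)]
    exact integrable_finsetSum _ fun x _ => integrable_finsetSum _ fun y _ => hi x y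
  have h := integral_re hi'
  simp only [RCLike.re_to_complex] at h
  rw [h, hf ((1 / 2 ^ n : ℂ) • (1 : Op n))]
  congr 1
  simp only [fun ψ => hf (reducedState n m ψ)]
  rw [integral_finsetSum _ fun x _ => integrable_finsetSum _ fun y _ => hi x y]
  refine Finset.sum_congr rfl fun x _ => ?_
  rw [integral_finsetSum _ fun y _ => hi x y]
  refine Finset.sum_congr rfl fun y _ => ?_
  rw [integral_mul_const, integral_reducedState]

/-! ### Lower bounds on the trace norm -/

/-- `Re tr (P_K X)`, where `P_K` is the orthogonal projection onto `K`. -/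
def reTraceProj {n : ℕ} (K : Submodule ℂ (EuclideanSpace ℂ (Qubits n))) (X : Op n) : ℝ :=
  (LinearMap.trace ℂ _ ((K.starProjection : EuclideanSpace ℂ (Qubits n) →ₗ[ℂ] _) ∘ₗ
    Matrix.toEuclideanLin X)).re

section

variable {n : ℕ} (K : Submodule ℂ (EuclideanSpace ℂ (Qubits n)))

theorem reTraceProj_eq_sum {ι : Type*} [Fintype ι]
    (v : OrthonormalBasis ι ℂ (EuclideanSpace ℂ (Qubits n))) (X : Op n) :
    reTraceProj K X = ∑ i, (inner ℂ (v i) (K.starProjection (Matrix.toEuclideanLin X (v i)))).re := by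
  rw [reTraceProj, LinearMap.trace_eq_sum_inner _ v, Complex.re_sum]
  rfl

theorem reTraceProj_sub (X Y : Op n) :
    reTraceProj K (X - Y) = reTraceProj K X - reTraceProj K Y := by
  simp [reTraceProj, LinearMap.comp_sub]

theorem reTraceProj_sum {ι : Type*} (s : Finset ι) (X : ι → Op n) :
    reTraceProj K (∑ i ∈ s, X i) = ∑ i ∈ s, reTraceProj K (X i) := by
  classical
  induction s using Finset.induction_on with
  | empty => simp [reTraceProj]
  | insert i s hi ih =>
    rw [Finset.sum_insert hi, Finset.sum_insert hi, ← ih]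
    simp [reTraceProj, LinearMap.comp_add]

theorem reTraceProj_smul (r : ℝ) (X : Op n) :
    reTraceProj K ((r : ℂ) • X) = r * reTraceProj K X := by
  rw [reTraceProj, map_smul, LinearMap.comp_smul, map_smul, smul_eq_mul, Complex.re_ofReal_mul,
    reTraceProj]

theorem norm_toEuclideanLin_eigenvectorBasis (X : Op n) (i : Qubits n) :
    ‖Matrix.toEuclideanLin X
        ((Matrix.isHermitian_conjTranspose_mul_self X).eigenvectorBasis i)‖ =
      Real.sqrt ((Matrix.isHermitian_conjTranspose_mul_self X).eigenvalues i) := by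
  set hX := Matrix.isHermitian_conjTranspose_mul_self X
  rw [hX.eigenvalues_eq, ← Matrix.mulVec_mulVec, Matrix.dotProduct_mulVec,
    ← Matrix.star_mulVec, dotProduct_comm, EuclideanSpace.norm_eq]
  congr 1
  simp [dotProduct, Complex.mul_conj', ← Complex.ofReal_pow, Matrix.toLpLin_apply]

/-- Evaluate the trace in the eigenbasis of `XᴴX`, where `‖X v_i‖` is the `i`-th singular value;
then use Cauchy–Schwarz and the contractivity of the projection. -/
theorem reTraceProj_le_traceNorm (X : Op n) : reTraceProj K X ≤ traceNorm X := by
  rw [reTraceProj_eq_sum K (Matrix.isHermitian_conjTranspose_mul_self X).eigenvectorBasis,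
    traceNorm]
  refine Finset.sum_le_sum fun i _ => ?_
  set v := (Matrix.isHermitian_conjTranspose_mul_self X).eigenvectorBasis
  calc _ ≤ ‖inner ℂ (v i) (K.starProjection (Matrix.toEuclideanLin X (v i)))‖ :=
        Complex.re_le_norm _
    _ ≤ ‖v i‖ * ‖K.starProjection (Matrix.toEuclideanLin X (v i))‖ := norm_inner_le_norm _ _
    _ ≤ 1 * ‖Matrix.toEuclideanLin X (v i)‖ := by
        rw [v.norm_eq_one]
        gcongr
        exact K.norm_starProjection_apply_le _
    _ = _ := by rw [one_mul, norm_toEuclideanLin_eigenvectorBasis]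

/-- The columns of a unitary matrix. -/
def unitaryColumn (M : Matrix.unitaryGroup (Qubits n) ℂ) (x : Qubits n) :
    EuclideanSpace ℂ (Qubits n) :=
  WithLp.toLp 2 fun y => M.1 y x

theorem orthonormal_unitaryColumn (M : Matrix.unitaryGroup (Qubits n) ℂ) :
    Orthonormal ℂ (unitaryColumn M) := by
  rw [orthonormal_iff_ite]
  intro x y
  have h := congrFun₂ (Matrix.UnitaryGroup.star_mul_self M) x y
  simpa [unitaryColumn, Matrix.mul_apply, PiLp.inner_apply, Matrix.one_apply,
    mul_comm] using h

/-- The columns of a unitary matrix, as an orthonormal basis. -/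
def unitaryColumnBasis (M : Matrix.unitaryGroup (Qubits n) ℂ) :
    OrthonormalBasis (Qubits n) ℂ (EuclideanSpace ℂ (Qubits n)) :=
  (basisOfOrthonormalOfCardEqFinrank (orthonormal_unitaryColumn M)
    (by simp)).toOrthonormalBasis (by simpa using orthonormal_unitaryColumn M)

theorem unitaryColumnBasis_apply (M : Matrix.unitaryGroup (Qubits n) ℂ) (x : Qubits n) :
    unitaryColumnBasis M x = unitaryColumn M x := by
  simp [unitaryColumnBasis]

theorem toEuclideanLin_conj_diagonal (M : Matrix.unitaryGroup (Qubits n) ℂ) (d : Qubits n → ℂ)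
    (x : Qubits n) :
    Matrix.toEuclideanLin (M.1 * Matrix.diagonal d * M.1ᴴ) (unitaryColumn M x) =
      d x • unitaryColumn M x := by
  have h : M.1 *ᵥ Pi.single x 1 = fun y => M.1 y x := by
    ext y; simp
  have h' : M.1ᴴ * M.1 = 1 := Matrix.UnitaryGroup.star_mul_self M
  rw [unitaryColumn, ← h, Matrix.toLpLin_toLp, Matrix.toLin'_apply, Matrix.mulVec_mulVec, mul_assoc, h', mul_one,
    ← Matrix.mulVec_mulVec, Matrix.diagonal_mulVec_single, mul_one, ← WithLp.toLp_smul,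
    ← Matrix.mulVec_smul]
  congr 2
  simp [← Pi.single_smul]

theorem inner_starProjection_self (v : EuclideanSpace ℂ (Qubits n)) :
    inner ℂ v (K.starProjection v) = ((‖K.starProjection v‖ ^ 2 : ℝ) : ℂ) := by
  have h : K.starProjection (K.starProjection v) = K.starProjection v :=
    Submodule.starProjection_eq_self_iff.2 (K.starProjection_apply_mem v)
  rw [← h, ← K.inner_starProjection_left_eq_right, h, inner_self_eq_norm_sq_to_K]
  simp

theorem reTraceProj_conj_paddedMixed (M : Matrix.unitaryGroup (Qubits n) ℂ) (m : ℕ) :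
    reTraceProj K (M.1 * paddedMixed n m * M.1ᴴ) =
      ∑ x : Qubits n, (if ∀ i : Fin n, (i : ℕ) < n - m → x i = false then (1 / 2 ^ m : ℝ) else 0) *
        ‖K.starProjection (unitaryColumn M x)‖ ^ 2 := by
  rw [reTraceProj_eq_sum K (unitaryColumnBasis M)]
  refine Finset.sum_congr rfl fun x _ => ?_
  rw [unitaryColumnBasis_apply, paddedMixed, toEuclideanLin_conj_diagonal, map_smul,
    inner_smul_right, inner_starProjection_self]
  split_ifs
  · rw [show (1 / 2 ^ m : ℂ) = ((1 / 2 ^ m : ℝ) : ℂ) by push_cast; rfl, ← Complex.ofReal_mul,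
      Complex.ofReal_re]
  · simp

theorem reTraceProj_conj_paddedMixed_nonneg (M : Matrix.unitaryGroup (Qubits n) ℂ) (m : ℕ) :
    0 ≤ reTraceProj K (M.1 * paddedMixed n m * M.1ᴴ) := by
  rw [reTraceProj_conj_paddedMixed]
  exact Finset.sum_nonneg fun x _ => mul_nonneg (by split_ifs <;> positivity) (by positivity)

theorem sum_norm_starProjection_sq (M : Matrix.unitaryGroup (Qubits n) ℂ) :
    ∑ x, ‖K.starProjection (unitaryColumn M x)‖ ^ 2 = Module.finrank ℂ K := by
  have h : LinearMap.IsProj K (K.starProjection : EuclideanSpace ℂ (Qubits n) →ₗ[ℂ] _) :=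
    ⟨K.starProjection_apply_mem, fun x hx => Submodule.starProjection_eq_self_iff.2 hx⟩
  have h1 := h.trace
  rw [LinearMap.trace_eq_sum_inner _ (unitaryColumnBasis M)] at h1
  simp only [unitaryColumnBasis_apply, ContinuousLinearMap.coe_coe, inner_starProjection_self,
    ← Complex.ofReal_sum] at h1
  exact_mod_cast h1

/-- All eigenvalues of the rotated state are at most `2^(-m)`, and the trace of the projection is
`dim K`. -/
theorem reTraceProj_conj_paddedMixed_le (M : Matrix.unitaryGroup (Qubits n) ℂ) (m : ℕ) :
    reTraceProj K (M.1 * paddedMixed n m * M.1ᴴ) ≤ 1 / 2 ^ m * Module.finrank ℂ K := by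
  rw [reTraceProj_conj_paddedMixed, ← sum_norm_starProjection_sq K M, Finset.mul_sum]
  gcongr
  split_ifs
  · rfl
  · positivity

/-- The labels of the basis states in the support of `paddedMixed n m`. -/
def paddedSupport (n m : ℕ) : Finset (Qubits n) :=
  {x | ∀ i : Fin n, (i : ℕ) < n - m → x i = false}

/-- The trace hypothesis replaces `m ≤ n`: for `m > n` the truncated `n - m` would leave only `2^n`
labels. -/
theorem card_paddedSupport {m : ℕ} (h : (paddedMixed n m).trace = 1) :
    (paddedSupport n m).card = 2 ^ m := by
  have h' : ((paddedSupport n m).card : ℂ) * (1 / 2 ^ m) = 1 := by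
    refine Eq.trans ?_ h
    rw [paddedMixed, Matrix.trace_diagonal, ← Finset.sum_filter, Finset.sum_const, paddedSupport,
      nsmul_eq_mul]
  rw [mul_one_div, div_eq_one_iff_eq (by positivity)] at h'
  exact_mod_cast h'

theorem reTraceProj_conj_paddedMixed_eq_one (M : Matrix.unitaryGroup (Qubits n) ℂ) {m : ℕ}
    (h : (paddedMixed n m).trace = 1) (hK : ∀ x ∈ paddedSupport n m, unitaryColumn M x ∈ K) :
    reTraceProj K (M.1 * paddedMixed n m * M.1ᴴ) = 1 := by
  rw [reTraceProj_conj_paddedMixed]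
  simp only [ite_mul, zero_mul]
  rw [← Finset.sum_filter]
  change ∑ x ∈ paddedSupport n m, _ = _
  have h1 : ∀ x ∈ paddedSupport n m,
      (1 / 2 ^ m : ℝ) * ‖K.starProjection (unitaryColumn M x)‖ ^ 2 = 1 / 2 ^ m := fun x hx => by
    rw [Submodule.starProjection_eq_self_iff.2 (hK x hx), (orthonormal_unitaryColumn M).1 x]
    simp
  rw [Finset.sum_congr rfl h1, Finset.sum_const, card_paddedSupport h]
  simp

end

/-! ### Low-entropy mixed unitary noise and the distance bound -/

/-- The labels of the probabilities that are at least `2 ^ (-(h + 1))`. -/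
def MixedUnitary.heavy {n : ℕ} (Γ : MixedUnitary n) (h : ℝ) : Finset (Fin Γ.r) :=
  {i | (2 : ℝ) ^ (-(h + 1)) ≤ Γ.p i}

theorem MixedUnitary.p_le_one {n : ℕ} (Γ : MixedUnitary n) (i : Fin Γ.r) : Γ.p i ≤ 1 := by
  rw [← Γ.p_sum]
  exact Finset.single_le_sum (fun j _ => Γ.p_nonneg j) (Finset.mem_univ i)

theorem MixedUnitary.entropy_nonneg {n : ℕ} (Γ : MixedUnitary n) : 0 ≤ Γ.entropy :=
  div_nonneg (Finset.sum_nonneg fun i _ => Real.negMulLog_nonneg (Γ.p_nonneg i) (Γ.p_le_one i))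
    (Real.log_nonneg one_le_two)

/-- Markov's inequality for the information content. -/
theorem MixedUnitary.one_div_le_sum_heavy {n : ℕ} (Γ : MixedUnitary n) {h : ℝ}
    (hΓ : Γ.entropy ≤ h) : 1 / (h + 1) ≤ ∑ i ∈ Γ.heavy h, Γ.p i := by
  have hh : 0 ≤ h := Γ.entropy_nonneg.trans hΓ
  have hl : 0 < Real.log 2 := Real.log_pos one_lt_two
  rw [entropy, div_le_iff₀ hl] at hΓ
  -- A light index has information content above `h + 1` bits, so the light mass is at most `h / (h
  -- + 1)`.
  have h1 : ∑ i ∈ (Γ.heavy h)ᶜ, Γ.p i * ((h + 1) * Real.log 2) ≤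
      ∑ i ∈ (Γ.heavy h)ᶜ, Real.negMulLog (Γ.p i) := by
    refine Finset.sum_le_sum fun i hi => ?_
    simp only [heavy, Finset.mem_compl, Finset.mem_filter, Finset.mem_univ, true_and, not_le] at hi
    rcases (Γ.p_nonneg i).eq_or_lt with h0 | h0
    · simp [← h0]
    · have := Real.log_le_log h0 hi.le
      rw [Real.log_rpow two_pos] at this
      rw [Real.negMulLog, neg_mul_comm]
      gcongr
      linarith
  have h2 : ∑ i ∈ (Γ.heavy h)ᶜ, Real.negMulLog (Γ.p i) ≤ ∑ i, Real.negMulLog (Γ.p i) :=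
    Finset.sum_le_univ_sum_of_nonneg fun i => Real.negMulLog_nonneg (Γ.p_nonneg i) (Γ.p_le_one i)
  rw [← Finset.sum_mul, ← mul_assoc] at h1
  have h3 := le_of_mul_le_mul_right ((h1.trans h2).trans hΓ) hl
  have h4 := Finset.sum_add_sum_compl (Γ.heavy h) Γ.p
  rw [Γ.p_sum] at h4
  rw [div_le_iff₀ (by positivity)]
  nlinarith

/-- The heavy mass is kept on the right: the cruder bound `2^(h+1)` would leave a projection bound
of `1/2`, useless against a heavy mass as small as `1/(h+1)`. -/
theorem MixedUnitary.card_heavy_le {n : ℕ} (Γ : MixedUnitary n) (h : ℝ) :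
    ((Γ.heavy h).card : ℝ) ≤ 2 ^ (h + 1) * ∑ i ∈ Γ.heavy h, Γ.p i := by
  have h1 : ((Γ.heavy h).card : ℝ) * 2 ^ (-(h + 1)) ≤ ∑ i ∈ Γ.heavy h, Γ.p i := by
    rw [← nsmul_eq_mul]
    exact Finset.card_nsmul_le_sum _ _ _ fun i hi => (Finset.mem_filter.1 hi).2
  rw [Real.rpow_neg two_pos.le, ← div_eq_mul_inv, div_le_iff₀ (by positivity)] at h1
  linarith

theorem MixedUnitary.reTraceProj_apply_keyAverage {n κ : ℕ} (Γ : MixedUnitary n) (m : ℕ)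
    (U : Qubits κ → Matrix.unitaryGroup (Qubits n) ℂ)
    (K : Submodule ℂ (EuclideanSpace ℂ (Qubits n))) :
    reTraceProj K (Γ.apply (keyAverage fun k => (U k).1 * paddedMixed n m * (U k).1ᴴ)) =
      ∑ i, Γ.p i * (1 / 2 ^ κ * ∑ k,
        reTraceProj K ((Γ.U i * U k).1 * paddedMixed n m * (Γ.U i * U k).1ᴴ)) := by
  rw [apply, reTraceProj_sum]
  refine Finset.sum_congr rfl fun i _ => ?_
  rw [reTraceProj_smul, keyAverage,
    show (1 / 2 ^ κ : ℂ) = ((1 / 2 ^ κ : ℝ) : ℂ) by push_cast; rfl, Matrix.mul_smul,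
    Matrix.smul_mul, reTraceProj_smul, Matrix.mul_sum, Matrix.sum_mul, reTraceProj_sum]
  simp [Matrix.mul_assoc]

/-- Mixed unitary noise of low entropy preserves the distance between key averages of padded
mixed states whose mixedness differs by more than the entropy of the key and the noise. -/
theorem MixedUnitary.one_div_le_traceNorm_sub {n κ a b : ℕ} (Γ : MixedUnitary n)
    (U V : Qubits κ → Matrix.unitaryGroup (Qubits n) ℂ) (ha : (paddedMixed n a).trace = 1)
    (hΓ : Γ.entropy ≤ (b : ℝ) - κ - a - 2) :
    1 / (2 * ((b : ℝ) - κ - a - 1)) ≤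
      traceNorm (Γ.apply (keyAverage fun k => (U k).1 * paddedMixed n a * (U k).1ᴴ) -
        Γ.apply (keyAverage fun k => (V k).1 * paddedMixed n b * (V k).1ᴴ)) := by
  set h : ℝ := (b : ℝ) - κ - a - 2 with hh
  set q := ∑ i ∈ Γ.heavy h, Γ.p i with hq
  -- Spanning vectors of the supports of all first-family states after heavy noise.
  let S : Finset (EuclideanSpace ℂ (Qubits n)) :=
    (Γ.heavy h ×ˢ (Finset.univ ×ˢ paddedSupport n a)).image fun z =>
      unitaryColumn (Γ.U z.1 * U z.2.1) z.2.2
  have hS : (S.card : ℝ) ≤ (Γ.heavy h).card * (2 ^ κ * 2 ^ a) := by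
    have : S.card ≤ _ := Finset.card_image_le
    rw [Finset.card_product, Finset.card_product, card_paddedSupport ha, Finset.card_univ,
      Fintype.card_fun, Fintype.card_bool, Fintype.card_fin] at this
    exact_mod_cast this
  set K := Submodule.span ℂ (S : Set (EuclideanSpace ℂ (Qubits n))) with hK
  have hdim : (Module.finrank ℂ K : ℝ) ≤ S.card := by
    exact_mod_cast finrank_span_finset_le_card S
  -- Heavy terms lie entirely inside `K` and contribute `p_i`; light terms contribute at least 0.
  have h0 : q ≤ reTraceProj K
      (Γ.apply (keyAverage fun k => (U k).1 * paddedMixed n a * (U k).1ᴴ)) := by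
    rw [Γ.reTraceProj_apply_keyAverage, hq]
    refine le_trans (Finset.sum_le_sum fun i hi => ?_) (Finset.sum_le_univ_sum_of_nonneg fun i =>
      mul_nonneg (Γ.p_nonneg i) (mul_nonneg (by positivity)
        (Finset.sum_nonneg fun k _ => reTraceProj_conj_paddedMixed_nonneg K _ _)))
    have : ∀ k, reTraceProj K ((Γ.U i * U k).1 * paddedMixed n a * (Γ.U i * U k).1ᴴ) = 1 :=
      fun k => reTraceProj_conj_paddedMixed_eq_one K _ ha fun x hx =>
        Submodule.subset_span <| Finset.mem_coe.2 <| Finset.mem_image.2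
          ⟨(i, k, x), by simp [hi, hx], rfl⟩
    rw [Finset.sum_congr rfl fun k _ => this k]
    simp
  have h1 : reTraceProj K (Γ.apply (keyAverage fun k => (V k).1 * paddedMixed n b * (V k).1ᴴ)) ≤
      1 / 2 ^ b * Module.finrank ℂ K := by
    rw [Γ.reTraceProj_apply_keyAverage]
    calc _ ≤ ∑ i, Γ.p i * (1 / 2 ^ κ * ∑ k : Qubits κ, 1 / 2 ^ b * (Module.finrank ℂ K : ℝ)) := by
          gcongr with i _ k _
          · exact Γ.p_nonneg i
          · exact reTraceProj_conj_paddedMixed_le K _ _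
      _ = _ := by
          rw [← Finset.sum_mul, Γ.p_sum]
          simp
  -- The 2 subtracted in `h` is spent here: one bit on the heaviness threshold `h + 1`, one on the
  -- factor `1/2`.
  have h2 : 1 / 2 ^ b * (Module.finrank ℂ K : ℝ) ≤ q / 2 := by
    calc 1 / 2 ^ b * (Module.finrank ℂ K : ℝ)
        ≤ 1 / 2 ^ b * ((2 ^ (h + 1) * q) * (2 ^ κ * 2 ^ a)) := by
          have := Γ.card_heavy_le h
          gcongr
          exact (hdim.trans hS).trans (by gcongr)
      _ = q / 2 := by
          have : (2 : ℝ) ^ (h + 1) = 2 ^ b / (2 ^ κ * 2 ^ a * 2) := by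
            rw [hh, show (b : ℝ) - κ - a - 2 + 1 = b - (κ + a + 1) by ring,
              Real.rpow_sub two_pos, Real.rpow_add two_pos, Real.rpow_add two_pos]
            simp
          rw [this]
          field_simp
  have h3 := reTraceProj_le_traceNorm K
    (Γ.apply (keyAverage fun k => (U k).1 * paddedMixed n a * (U k).1ᴴ) -
        Γ.apply (keyAverage fun k => (V k).1 * paddedMixed n b * (V k).1ᴴ))
  rw [reTraceProj_sub] at h3
  have h4 := Γ.one_div_le_sum_heavy hΓ
  rw [show (b : ℝ) - κ - a - 1 = h + 1 by rw [hh]; ring, mul_comm, ← div_div]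
  linarith

/-! ### Computational indistinguishability -/

theorem Negligible.of_le_add {f g h : ℕ → ℝ} (hf : Negligible f) (hg : Negligible g)
    (hle : ∀ κ, |h κ| ≤ |f κ| + |g κ|) : Negligible h := by
  intro c
  -- The spare power absorbs the factor 2 from the sum once `κ ≥ 2`.
  obtain ⟨a, ha⟩ := hf (c + 1)
  obtain ⟨b, hb⟩ := hg (c + 1)
  refine ⟨max (max a b) 2, fun κ hκ => ?_⟩
  simp only [max_lt_iff] at hκ
  have h2 : (2 : ℝ) ≤ κ := by exact_mod_cast hκ.2.le
  have h3 : ((κ : ℝ) ^ (c + 1))⁻¹ ≤ ((κ : ℝ) ^ c)⁻¹ / 2 := by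
    rw [pow_succ, mul_inv, div_eq_mul_inv]
    gcongr
  linarith [ha κ hκ.1.1, hb κ hκ.1.2, hle κ]

/-- The acceptance probability of a circuit, as the real part of a linear functional. -/
theorem Circuit.exists_linearMap_accept {𝒢 : GateSet} {n : ℕ} (c : Circuit 𝒢 n 1) :
    ∃ f : Op n →ₗ[ℂ] ℂ, ∀ ρ, c.accept ρ = (f ρ).re :=
  ⟨Matrix.entryLinearMap ℂ ℂ _ _ ∘ₗ c.runLinear, fun ρ => by
    rw [accept, run_eq_runLinear]; rfl⟩

theorem Circuit.accept_keyAverage {𝒢 : GateSet} {n κ : ℕ} (c : Circuit 𝒢 n 1)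
    (ρ : Qubits κ → Op n) :
    c.accept (keyAverage ρ) = 1 / 2 ^ κ * ∑ k, c.accept (ρ k) := by
  obtain ⟨f, hf⟩ := c.exists_linearMap_accept
  simp only [hf, keyAverage, map_smul, map_sum, smul_eq_mul, ← Complex.re_sum]
  rw [show (1 / 2 ^ κ : ℂ) = ((1 / 2 ^ κ : ℝ) : ℂ) by push_cast; rfl, Complex.re_ofReal_mul]

/-- A single copy of a VPRDM with a random key looks maximally mixed. -/
theorem IsVPRDM.negligible_keyAverage {𝒢 : GateSet} {n m : ℕ → ℕ}
    {ρ : ∀ κ, Qubits κ → Op (n κ)} (hρ : IsVPRDM 𝒢 n m ρ) (A : QPT 𝒢 n fun _ => 1) :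
    Negligible fun κ => |(A.circuit κ).accept (keyAverage (ρ κ)) -
      (A.circuit κ).accept ((1 / 2 ^ n κ : ℂ) • (1 : Op (n κ)))| := by
  have h := hρ.pseudorandom (fun _ => 1) ⟨1, fun _ => by simp⟩
    (A.castInput fun κ => (one_mul (n κ)).symm)
  have hc (κ : ℕ) (σ : Op (n κ)) : ((A.castInput fun κ => (one_mul (n κ)).symm).circuit κ).accept
      (copies 1 σ) = (A.circuit κ).accept σ := by
    rw [Circuit.accept, QPT.castInput, Circuit.run_castInput, copies_one_submatrix, Circuit.accept]
  convert h using 3 with κ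
  simp only [hc]
  congr 1
  · exact (A.circuit κ).accept_keyAverage _
  · obtain ⟨f, hf⟩ := (A.circuit κ).exists_linearMap_accept
    simp only [hf, integral_re_linear_reducedState]

theorem IsState.keyAverage {n κ : ℕ} {ρ : Qubits κ → Op n} (h : ∀ k, IsState (ρ k)) :
    IsState (keyAverage ρ) := by
  constructor
  · refine Matrix.PosSemidef.smul (Matrix.posSemidef_sum _ fun k _ => (h k).1) ?_
    positivity
  · simp [_root_.keyAverage, Matrix.trace_smul, Matrix.trace_sum, (h _).2]

theorem eventually_inv_sq_le {c : ℝ} (hc : 0 < c) {n : ℕ → ℕ}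
    (hn : ∀ κ : ℕ, |(κ : ℝ) - c * n κ| ≤ 1) :
    ∀ᶠ κ : ℕ in atTop, ((κ : ℝ) ^ 2)⁻¹ ≤ 1 / (2 * (n κ : ℝ)) := by
  -- Here `c n ≤ κ + 1`, so `2 c n ≤ 2(κ + 1) ≤ 4κ ≤ c κ²` once `κ ≥ 4/c`; and `κ ≥ 2` excludes `n =
  -- 0`.
  filter_upwards [tendsto_natCast_atTop_atTop.eventually_ge_atTop (4 / c),
    eventually_ge_atTop 2] with κ h1 h2
  have h2' : (2 : ℝ) ≤ κ := by exact_mod_cast h2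
  have h3 := abs_le.1 (hn κ)
  have hnpos : 0 < (n κ : ℝ) := by
    by_contra h
    nlinarith
  rw [div_le_iff₀ hc] at h1
  rw [inv_eq_one_div]
  apply one_div_le_one_div_of_le (by positivity)
  refine le_of_mul_le_mul_right (a := c) ?_ hc
  nlinarith

theorem trace_paddedMixed_of_isState {n m : ℕ} (U : Matrix.unitaryGroup (Qubits n) ℂ)
    (h : IsState (U.1 * paddedMixed n m * U.1ᴴ)) : (paddedMixed n m).trace = 1 := by
  have h' : U.1ᴴ * U.1 = 1 := Matrix.UnitaryGroup.star_mul_self U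
  rw [← h.2, Matrix.trace_mul_comm, ← mul_assoc, h', one_mul]

end

theorem mainTheorem7 (𝒢 : GateSet) (c γ : ℝ) (hc : 0 < c) (hcγ : c < γ) (hγ : γ < 1)
    (n m₀ m₁ : ℕ → ℕ) (hm₀n : ∀ κ, m₀ κ ≤ n κ) (hm₁n : ∀ κ, m₁ κ ≤ n κ)
    (hn : ∀ κ : ℕ, |(κ : ℝ) - c * n κ| ≤ 1)
    (hm₀ : ∃ a : ℕ, (fun κ => (m₀ κ : ℝ)) =O[atTop] fun κ => Real.log (n κ) ^ a)
    (hm₁ : ∀ κ : ℕ, |(m₁ κ : ℝ) - γ * n κ| ≤ 1)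
    (U₀ U₁ : ∀ κ, Qubits κ → Matrix.unitaryGroup (Qubits (n κ)) ℂ)
    (ρ₀ ρ₁ : ∀ κ, Qubits κ → Op (n κ))
    (hρ₀ : ∀ κ k, ρ₀ κ k = (U₀ κ k).1 * paddedMixed (n κ) (m₀ κ) * (U₀ κ k).1ᴴ)
    (hρ₁ : ∀ κ k, ρ₁ κ k = (U₁ κ k).1 * paddedMixed (n κ) (m₁ κ) * (U₁ κ k).1ᴴ)
    (hV₀ : IsVPRDM 𝒢 n m₀ ρ₀) (hV₁ : IsVPRDM 𝒢 n m₁ ρ₁)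
    (Γ : ∀ κ, MixedUnitary (n κ)) (hΓ : EfficientNoise 𝒢 n Γ)
    (hH : ∀ᶠ κ : ℕ in atTop, (Γ κ).entropy ≤ (m₁ κ : ℝ) - κ - m₀ κ - 2) :
    IsEFI 𝒢 n (fun κ => (Γ κ).apply (keyAverage (ρ₀ κ)))
      (fun κ => (Γ κ).apply (keyAverage (ρ₁ κ))) := by

  obtain ⟨D, hD⟩ := hΓ
  have hstate₀ κ := IsState.keyAverage (hV₀.state κ)
  have hstate₁ κ := IsState.keyAverage (hV₁.state κ)
  obtain ⟨G₀, hG₀⟩ := hV₀.preparable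
  obtain ⟨G₁, hG₁⟩ := hV₁.preparable
  obtain ⟨P₀, hP₀⟩ := exists_qpt_keyAverage G₀ hG₀
  obtain ⟨P₁, hP₁⟩ := exists_qpt_keyAverage G₁ hG₁
  refine ⟨⟨P₀.comp D, fun κ => ?_⟩, ⟨P₁.comp D, fun κ => ?_⟩, ⟨2, ?_⟩, fun A => ?_⟩
  · rw [QPT.comp, Circuit.run_comp, hP₀, hD κ _ (hstate₀ κ)]
  · rw [QPT.comp, Circuit.run_comp, hP₁, hD κ _ (hstate₁ κ)]
  · filter_upwards [hH, eventually_inv_sq_le hc hn] with κ hκ hnκ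
    have htr := trace_paddedMixed_of_isState (U₀ κ default) (hρ₀ κ default ▸ hV₀.state κ default)
    have hdist := (Γ κ).one_div_le_traceNorm_sub (U₀ κ) (U₁ κ) htr hκ
    rw [← funext (hρ₀ κ), ← funext (hρ₁ κ)] at hdist
    refine hnκ.trans (le_trans (one_div_le_one_div_of_le ?_ ?_) hdist)
    -- Nonnegative entropy forces `m₁ - κ - m₀ ≥ 2`, so the denominator is positive.
    · linarith [(Γ κ).entropy_nonneg]
    · have : (m₁ κ : ℝ) ≤ n κ := by exact_mod_cast hm₁n κ
      have : (0 : ℝ) ≤ κ := by positivity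
      have : (0 : ℝ) ≤ m₀ κ := by positivity
      linarith
  -- The distinguisher preceded by the noise is again QPT. Both families are compared with its
  -- acceptance on `I / 2^n`, which cancels in the triangle inequality.
  · refine (hV₀.negligible_keyAverage (D.comp A)).of_le_add
      (hV₁.negligible_keyAverage (D.comp A)) fun κ => ?_
    have hacc (σ : Op (n κ)) : ((D.comp A).circuit κ).accept σ =
        (A.circuit κ).accept ((D.circuit κ).run σ) := by
      rw [Circuit.accept, QPT.comp, Circuit.run_comp, Circuit.accept]
    simp only [hacc, hD κ _ (hstate₀ κ), hD κ _ (hstate₁ κ), abs_abs]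
    rw [abs_sub_comm ((A.circuit κ).accept ((Γ κ).apply (keyAverage (ρ₁ κ))))]
    exact abs_sub_le _ _ _
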